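/- A set-theoretic solution of the Yang--Baxter equation is a pair $(X,r)$, where $X$ is a non-empty set and $r\colon X\times X\to X\times X$ is a bijection with $r_1r_2r_1=r_2r_1r_2$ for $r_1=r\times\mathrm{id}$ and $r_2=\mathrm{id}\times r$. Write $r(x,y)=(f_x(y),g_y(x))$. The solution is non-degenerate if all $f_x$ and $g_x$ are bijective, and involutive if $r^2=\mathrm{id}$. An isomorphism $(X,r)\to(Z,t)$ is a bijection $F$ with $t\circ(F\times F)=(F\times F)\circ r$. A left brace is a set $B$ with an abelian group structure $(B,+)$ and a group structure $(B,\cdot)$ such that $a(b+c)+a=ab+ac$ for all $a,b,c\in B$; an isomorphism of left braces is a bijection preserving $+$ and $\cdot$. Put $\lambda_a(b)=-a+ab$; this is an action of $(B,\cdot)$ on $(B,+)$ by automorphisms. Let $\mathcal O$ be the set of its orbits and $\mathrm{St}(a)=\{b\in B:\lambda_b(a)=a\}$. For an involutive non-degenerate solution $(X,r)$, the structure group $G(X,r)=\langle X\mid xy=f_x(y)g_y(x),\ x,y\in X\rangle$, which acts on $X$ through $x\mapsto f_x$ (write $f_b$ for the action of $b$), is a left brace for the unique abelian group structure $+$ with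 $b+x=b\cdot f_b^{-1}(x)$ for all $b\in G(X,r)$, $x\in X$. The permutation group $\mathcal G(X,r)$ is the subgroup of $\mathrm{Sym}_X\times\mathrm{Sym}_X$ generated by the pairs $(f_x,\tilde g_x^{-1})$, $x\in X$, where $\tilde g_x(y)=g_{f_y^{-1}(x)}(y)$. It is a left brace with the sum induced by the surjective homomorphism $G(X,r)\to\mathcal G(X,r)$, $x\mapsto(f_x,\tilde g_x^{-1})$. **Theorem.** Let $B$ be a left brace and choose an element $a_i\in i$ for each $i\in\mathcal O$. (1) Let $I\subseteq\mathcal O$ be a non-empty subset such that $\bigcup_{i\in I}i$ generates the group $(B,+)$. For each $i\in I$ let $J_i$ be a non-empty set and $\{K_{i,j}\}_{j\in J_i}$ a family of subgroups of $\mathrm{St}(a_i)$, such that $$\bigcap_{i\in I}\bigcap_{j\in J_i}\bigcap_{b\in B}bK_{i,j}b^{-1}=\{1\}.$$ Let $X=\bigsqcup_{i\in I}\bigsqcup_{j\in J_i}B/K_{i,j}$ be the disjoint union of the sets of left cosets in $(B,\cdot)$. For $x=b_1K_{i_1,j_1}$ and $y=b_2K_{i_2,j_2}$ in $X$ put $$f_x(y)=\lambda_{b_1}(a_{i_1})\,b_2K_{i_2,j_2},\qquad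 r(x,y)=\bigl(f_x(y),\,f_{f_x(y)}^{-1}(x)\bigr).$$ Then $(X,r)$ is an involutive non-degenerate solution, and $\mathcal G(X,r)\cong B$ as left braces. (2) Conversely, every involutive non-degenerate solution $(Z,t)$ with $\mathcal G(Z,t)\cong B$ as left braces is isomorphic to a solution $(X,r)$ constructed as in (1), with the same chosen elements $a_i$, for some $I$, $J_i$ and $K_{i,j}$. -/

import Mathlib

set_option linter.style.haveILetI false

/-! ### Left braces -/

/-- A left brace: an abelian group `(B, +)` and a group `(B, *)` on the same set such that
`a * (b + c) + a = a * b + a * c`. -/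
class LeftBrace (B : Type*) extends AddCommGroup B, Group B where
  mul_add_add' : ∀ a b c : B, a * (b + c) + a = a * b + a * c

namespace LeftBrace

/-- Isomorphism of left braces: a bijection that preserves the sum and the product. -/
def Isomorphic (A B : Type*) [LeftBrace A] [LeftBrace B] : Prop :=
  ∃ e : A ≃ B, (∀ x y, e (x + y) = e x + e y) ∧ (∀ x y, e (x * y) = e x * e y)

variable {B : Type*} [LeftBrace B]

/-- The map `λ_a(b) = -a + a * b`. -/
def lam (a b : B) : B := -a + a * b

theorem mul_add_add (a b c : B) : a * (b + c) + a = a * b + a * c :=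
  LeftBrace.mul_add_add' a b c

theorem mul_zero_eq (a : B) : a * 0 = a := by
  have h := mul_add_add a 0 0
  rw [add_zero] at h
  exact (add_left_cancel h).symm

theorem zero_eq_one : (0 : B) = 1 := by
  have h := mul_zero_eq (1 : B)
  rwa [one_mul] at h

theorem mul_eq (a b : B) : a * b = a + lam a b := by simp [lam]

theorem lam_add (a b c : B) : lam a (b + c) = lam a b + lam a c := by
  have h := mul_add_add a b c
  have h' : a * (b + c) = a * b + a * c - a := eq_sub_of_add_eq h
  simp only [lam, h']
  abel

theorem lam_mul (a b c : B) : lam (a * b) c = lam a (lam b c) := by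
  have h : a * (b * c) = a + (lam a b + lam a (lam b c)) := by
    rw [mul_eq b c, mul_eq a, lam_add]
  simp only [lam, mul_assoc] at *
  rw [h]
  abel

theorem lam_one (c : B) : lam 1 c = c := by
  rw [lam, one_mul, ← zero_eq_one]
  simp

/-- The orbit `{λ_b(a) : b ∈ B}` of `a`. -/
def lamOrbit (a : B) : Set B := {c | ∃ b : B, lam b a = c}

variable (B) in
/-- The set of all orbits of the action `λ`. -/
def LamOrbits : Set (Set B) := Set.range (lamOrbit (B := B))

/-- The stabiliser of `a` under `λ`, as a subgroup of `(B, *)`. -/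
def St (a : B) : Subgroup B where
  carrier := {b | lam b a = a}
  mul_mem' := by
    intro x y hx hy
    simp only [Set.mem_ofPred_eq] at *
    rw [lam_mul, hy, hx]
  one_mem' := lam_one a
  inv_mem' := by
    intro x hx
    simp only [Set.mem_ofPred_eq] at *
    conv_lhs => rw [← hx]
    rw [← lam_mul, inv_mul_cancel, lam_one]

end LeftBrace

/-! ### Set-theoretic solutions of the Yang-Baxter equation -/

namespace YB

variable {X : Type*}

/-- The first component: `r (x, y) = (f_x(y), g_y(x))`. -/
def f (r : X × X → X × X) (x y : X) : X := (r (x, y)).1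

/-- The second component: `r (x, y) = (f_x(y), g_y(x))`. -/
def g (r : X × X → X × X) (y x : X) : X := (r (x, y)).2

/-- `r × id` on `X × X × X`. -/
def r₁ (r : X × X → X × X) : X × X × X → X × X × X :=
  fun p => ((r (p.1, p.2.1)).1, (r (p.1, p.2.1)).2, p.2.2)

/-- `id × r` on `X × X × X`. -/
def r₂ (r : X × X → X × X) : X × X × X → X × X × X :=
  fun p => (p.1, r p.2)

/-- `(X, r)` is a set-theoretic solution of the Yang-Baxter equation. -/
structure IsSolution (r : X × X → X × X) : Prop where
  nonempty : Nonempty X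
  bijective : Function.Bijective r
  braid : r₁ r ∘ r₂ r ∘ r₁ r = r₂ r ∘ r₁ r ∘ r₂ r

/-- All the maps `f_x` and `g_x` are invertible. -/
def NonDegenerate (r : X × X → X × X) : Prop :=
  ∀ x : X, Function.Bijective (f r x) ∧ Function.Bijective (g r x)

/-- An involutive non-degenerate solution. -/
structure IsInvSolution (r : X × X → X × X) : Prop extends IsSolution r where
  nonDegenerate : NonDegenerate r
  involutive : r ∘ r = id

/-- Isomorphism of solutions: a bijection `F` with `s ∘ (F × F) = (F × F) ∘ r`. -/
def SolIsomorphic {Y : Type*} (r : X × X → X × X) (s : Y × Y → Y × Y) : Prop :=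
  ∃ F : X ≃ Y, ∀ x₁ x₂ : X, s (F x₁, F x₂) = Prod.map F F (r (x₁, x₂))

section invSolution

variable {r : X × X → X × X}

theorem f_f_g (h : IsInvSolution r) (x y : X) : f r (f r x y) (g r y x) = x :=
  congrArg Prod.fst (congrFun h.involutive (x, y))

theorem g_g_f (h : IsInvSolution r) (x y : X) : g r (g r y x) (f r x y) = y :=
  congrArg Prod.snd (congrFun h.involutive (x, y))

theorem f_f (h : IsInvSolution r) (x y z : X) : f r (f r x y) (f r (g r y x) z) = f r x (f r y z) :=
  congrArg (fun p : X × X × X => p.1) (congrFun h.braid (x, y, z))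

end invSolution

/-- `f_x` as a permutation of `X`. -/
noncomputable def fPerm {r : X × X → X × X} (h : IsInvSolution r) (x : X) : Equiv.Perm X :=
  Equiv.ofBijective (f r x) (h.nonDegenerate x).1

theorem fPerm_apply {r : X × X → X × X} (h : IsInvSolution r) (x y : X) :
    fPerm h x y = f r x y := rfl

theorem g_eq {r : X × X → X × X} (h : IsInvSolution r) (x y : X) :
    g r y x = (fPerm h (f r x y))⁻¹ x := by
  rw [Equiv.Perm.eq_inv_iff_eq]
  exact f_f_g h x y

theorem fPerm_mul {r : X × X → X × X} (h : IsInvSolution r) (x y : X) :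
    fPerm h x * fPerm h y = fPerm h (f r x y) * fPerm h (g r y x) := by
  ext z
  exact (f_f h x y z).symm

/-- The permutation `g̃_x` of `X`, where `g̃_x(y) = g_z(y)` with `z = f_y⁻¹(x)`. -/
noncomputable def gTilde {r : X × X → X × X} (h : IsInvSolution r) (x : X) : Equiv.Perm X where
  toFun y := g r ((fPerm h y)⁻¹ x) y
  invFun y := f r x y
  left_inv y := by
    have e : f r y ((fPerm h y)⁻¹ x) = x := (fPerm h y).apply_symm_apply x
    have := f_f_g h y ((fPerm h y)⁻¹ x)
    rwa [e] at this
  right_inv y := by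
    have e : f r (f r x y) (g r y x) = x := f_f_g h x y
    have e' : (fPerm h (f r x y))⁻¹ x = g r y x := (g_eq h x y).symm
    change g r ((fPerm h (f r x y))⁻¹ x) (f r x y) = y
    rw [e']
    exact g_g_f h x y

theorem gTilde_inv {r : X × X → X × X} (h : IsInvSolution r) (x : X) :
    (gTilde h x)⁻¹ = fPerm h x := by
  ext y
  rfl

/-! ### The structure group and its left brace structure -/

/-- The defining relations `x * y = f_x(y) * g_y(x)` of the structure group. -/
def structureRels (r : X × X → X × X) : Set (FreeGroup X) :=
  {w | ∃ x y : X, w = (FreeGroup.of x * FreeGroup.of y) *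
    (FreeGroup.of (f r x y) * FreeGroup.of (g r y x))⁻¹}

/-- The structure group `⟨X | x * y = f_x(y) * g_y(x)⟩`. -/
abbrev StructureGroup (r : X × X → X × X) : Type _ := PresentedGroup (structureRels r)

/-- The natural map from `X` to the structure group. -/
def ι (r : X × X → X × X) (x : X) : StructureGroup r := PresentedGroup.of x

theorem ι_mul (r : X × X → X × X) (x y : X) :
    ι r x * ι r y = ι r (f r x y) * ι r (g r y x) := by
  have h : PresentedGroup.mk (structureRels r) ((FreeGroup.of x * FreeGroup.of y) *
      (FreeGroup.of (f r x y) * FreeGroup.of (g r y x))⁻¹) = 1 :=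
    PresentedGroup.one_of_mem ⟨x, y, rfl⟩
  rw [map_mul, map_inv, map_mul, map_mul] at h
  exact mul_inv_eq_one.mp h

section structureBrace

variable {r : X × X → X × X} (h : IsInvSolution r)

/-- The action of the structure group on `X` that extends `x ↦ f_x`. -/
noncomputable def fHom : StructureGroup r →* Equiv.Perm X :=
  PresentedGroup.toGroup (f := fPerm h) (by
    rintro _ ⟨x, y, rfl⟩
    rw [map_mul, map_inv, map_mul, map_mul]
    simp only [FreeGroup.lift_apply_of]
    exact mul_inv_eq_one.mpr (fPerm_mul h x y))

theorem fHom_ι (x : X) : fHom h (ι r x) = fPerm h x := PresentedGroup.toGroup.of _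

theorem ι_comm (u v : X) :
    ι r u * ι r ((fPerm h u)⁻¹ v) = ι r v * ι r ((fPerm h v)⁻¹ u) := by
  have e : f r u ((fPerm h u)⁻¹ v) = v := (fPerm h u).apply_symm_apply v
  rw [ι_mul, e]
  congr 2
  rw [g_eq h, e]

theorem diag_bijective : Function.Bijective (fun z : X => (fPerm h z)⁻¹ z) := by
  have key : ∀ z : X, g r ((fPerm h z)⁻¹ z) z = (fPerm h z)⁻¹ z := by
    intro z
    have e : f r z ((fPerm h z)⁻¹ z) = z := (fPerm h z).apply_symm_apply z
    rw [g_eq h, e]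
  constructor
  · intro z z' hz
    simp only at hz
    have k := key z
    have k' := key z'
    rw [← hz] at k'
    exact (h.nonDegenerate _).2.1 (k.trans k'.symm)
  · intro w
    obtain ⟨z, hz⟩ := (h.nonDegenerate w).2.2 w
    refine ⟨z, ?_⟩
    have h1 := g_g_f h z w
    rw [hz] at h1
    have h2 : f r z w = z := (h.nonDegenerate w).2.1 (h1.trans hz.symm)
    change (fPerm h z)⁻¹ z = w
    rw [Equiv.Perm.inv_eq_iff_eq]
    exact h2.symm

theorem transl_bijective (x : X) :
    Function.Bijective (fun b : StructureGroup r => b * ι r ((fHom h b)⁻¹ x)) := by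
  have key : ∀ (b : StructureGroup r) (u : X), u = (fHom h b)⁻¹ x →
      (fHom h (b * ι r u))⁻¹ x = (fPerm h u)⁻¹ u := by
    intro b u hu
    rw [map_mul, fHom_ι, mul_inv_rev, Equiv.Perm.mul_apply, ← hu]
  constructor
  · intro b b' hb
    simp only at hb
    have k := key b _ rfl
    have k' := key b' _ rfl
    rw [← hb, k] at k'
    have e := (diag_bijective h).1 k'
    rw [e] at hb
    exact mul_right_cancel hb
  · intro c
    obtain ⟨z, hz⟩ := (diag_bijective h).2 ((fHom h c)⁻¹ x)
    refine ⟨c * (ι r z)⁻¹, ?_⟩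
    have e : (fHom h (c * (ι r z)⁻¹))⁻¹ x = z := by
      rw [map_mul, map_inv, fHom_ι, mul_inv_rev, inv_inv, Equiv.Perm.mul_apply, ← hz]
      exact (fPerm h z).apply_symm_apply z
    simp only [e, inv_mul_cancel_right]

/-- The permutation `b ↦ b * ι(f_b⁻¹(x))` of the structure group: the translation
`b ↦ b + ι(x)` of the sum defined below. -/
noncomputable def transl (x : X) : Equiv.Perm (StructureGroup r) :=
  Equiv.ofBijective _ (transl_bijective h x)

theorem transl_apply (x : X) (b : StructureGroup r) :
    transl h x b = b * ι r ((fHom h b)⁻¹ x) := rfl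

theorem transl_comm (x y : X) : transl h x * transl h y = transl h y * transl h x := by
  ext b
  simp only [Equiv.Perm.mul_apply, transl_apply, map_mul, mul_inv_rev, fHom_ι, mul_assoc]
  rw [ι_comm h]

/-- The group of translations, an abelian group generated by the `transl x`. -/
noncomputable def translGroup : Subgroup (Equiv.Perm (StructureGroup r)) :=
  Subgroup.closure (Set.range (transl h))

noncomputable instance : CommGroup (translGroup h) :=
  { (inferInstance : Group (translGroup h)) with
    mul_comm :=
      (Subgroup.isMulCommutative_closure (k := Set.range (transl h)) (by
        rintro _ ⟨x, rfl⟩ _ ⟨y, rfl⟩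
        exact transl_comm h x y)).is_comm.comm }

theorem transl_mem (x : X) : transl h x ∈ translGroup h :=
  Subgroup.subset_closure ⟨x, rfl⟩

theorem closure_ι : Subgroup.closure (Set.range (ι r)) = ⊤ :=
  PresentedGroup.closure_range_of _

theorem translGroup_bijective :
    Function.Bijective (fun t : translGroup h => t.1 (1 : StructureGroup r)) := by
  have surj : ∀ b : StructureGroup r, ∃ t : translGroup h, t.1 1 = b := by
    intro b
    have hb : b ∈ Subgroup.closure (Set.range (ι r)) := by rw [closure_ι]; trivial
    induction hb using Subgroup.closure_induction_right with
    | one => exact ⟨1, rfl⟩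
    | mul_right b _ y hy ih =>
      obtain ⟨t, ht⟩ := ih
      obtain ⟨x, rfl⟩ := hy
      refine ⟨⟨transl h (fHom h b x), transl_mem h _⟩ * t, ?_⟩
      change transl h (fHom h b x) (t.1 1) = _
      rw [ht, transl_apply]
      simp
    | mul_inv_cancel b _ y hy ih =>
      obtain ⟨t, ht⟩ := ih
      obtain ⟨x, rfl⟩ := hy
      refine ⟨⟨transl h (fHom h (b * (ι r x)⁻¹) x), transl_mem h _⟩⁻¹ * t, ?_⟩
      change (transl h (fHom h (b * (ι r x)⁻¹) x))⁻¹ (t.1 1) = _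
      rw [ht, Equiv.Perm.inv_eq_iff_eq, transl_apply]
      simp
  refine ⟨?_, surj⟩
  intro t t' ht
  apply Subtype.ext
  ext b
  obtain ⟨s, hs⟩ := surj b
  have e : ∀ u : translGroup h, u.1 b = s.1 (u.1 1) := by
    intro u
    rw [← hs]
    exact congrArg (fun v : translGroup h => v.1 1) (mul_comm u s)
  have ht' : t.1 1 = t'.1 1 := ht
  rw [e t, e t', ht']

/-- The bijection between the structure group and the group of translations. -/
noncomputable def translEquiv : StructureGroup r ≃ Additive (translGroup h) :=
  (Equiv.ofBijective _ (translGroup_bijective h)).symm.trans Additive.ofMul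

theorem translEquiv_apply_one (b : StructureGroup r) :
    (translEquiv h b).toMul.1 1 = b :=
  (Equiv.ofBijective _ (translGroup_bijective h)).apply_symm_apply b

/-- The sum of the structure group, the one for which the bijection above is additive.
It is the sum with `b + ι(x) = b * ι(f_b⁻¹(x))`. -/
noncomputable abbrev structureAddCommGroup : AddCommGroup (StructureGroup r) :=
  (translEquiv h).addCommGroup

theorem structure_add_def (a b : StructureGroup r) :
    letI := structureAddCommGroup h
    a + b = (translEquiv h b).toMul.1 a := by
  letI := structureAddCommGroup h
  have e : translEquiv h (a + b) = translEquiv h a + translEquiv h b := by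
    exact (translEquiv h).apply_symm_apply _
  have e' : (translEquiv h (a + b)).toMul =
      (translEquiv h b).toMul * (translEquiv h a).toMul := by
    rw [e, toMul_add, mul_comm]
  conv_lhs => rw [← translEquiv_apply_one h (a + b), e']
  change (translEquiv h b).toMul.1 ((translEquiv h a).toMul.1 1) = _
  rw [translEquiv_apply_one]

theorem eq_translEquiv (t : translGroup h) (c : StructureGroup r) (hc : t.1 1 = c) :
    (translEquiv h c).toMul = t :=
  (translGroup_bijective h).1 ((translEquiv_apply_one h c).trans hc.symm)

theorem transl_conj (a : StructureGroup r) (t : translGroup h) :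
    ∃ t' : translGroup h, ∀ b, a * t.1 b = t'.1 (a * b) := by
  obtain ⟨t, ht⟩ := t
  simp only
  induction ht using Subgroup.closure_induction with
  | mem y hy =>
    obtain ⟨x, rfl⟩ := hy
    refine ⟨⟨transl h (fHom h a x), transl_mem h _⟩, fun b => ?_⟩
    simp [transl_apply, mul_assoc]
  | one => exact ⟨1, fun b => rfl⟩
  | mul s t _ _ hs ht =>
    obtain ⟨s', hs⟩ := hs
    obtain ⟨t', ht⟩ := ht
    refine ⟨s' * t', fun b => ?_⟩
    rw [Equiv.Perm.mul_apply, hs, ht]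
    rfl
  | inv s _ hs =>
    obtain ⟨s', hs⟩ := hs
    refine ⟨s'⁻¹, fun b => ?_⟩
    change _ = (s'.1)⁻¹ (a * b)
    rw [eq_comm, Equiv.Perm.inv_eq_iff_eq, ← hs]
    simp

/-- The left brace structure of the structure group. -/
noncomputable abbrev structureBrace : LeftBrace (StructureGroup r) :=
  { structureAddCommGroup h, (inferInstance : Group (StructureGroup r)) with
    mul_add_add' := by
      letI := structureAddCommGroup h
      intro a b c
      obtain ⟨t', ht⟩ := transl_conj h a (translEquiv h c).toMul
      have h1 : a * (b + c) = t'.1 (a * b) := by rw [structure_add_def, ht]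
      have h2 : a * c = t'.1 a := by
        have := ht 1
        rwa [translEquiv_apply_one, mul_one] at this
      obtain ⟨d, hd⟩ : ∃ d, t'.1 1 = d := ⟨_, rfl⟩
      have h3 : ∀ e, t'.1 e = e + d := by
        intro e
        rw [structure_add_def, eq_translEquiv h t' d hd]
      change a * (b + c) + a = a * b + a * c
      rw [h1, h2, h3, h3, add_assoc, add_comm d a] }

/-- The sum of the structure group satisfies `b + ι(x) = b * ι(f_b⁻¹(x))`. -/
theorem structure_add_ι (b : StructureGroup r) (x : X) :
    letI := structureBrace h
    b + ι r x = b * ι r ((fHom h b)⁻¹ x) := by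
  let := structureBrace h
  change _ = transl h x b
  refine (structure_add_def h b (ι r x)).trans ?_
  rw [eq_translEquiv h ⟨transl h x, transl_mem h x⟩ (ι r x)]
  simp [transl_apply]

/-- The images of the elements of `X` generate the additive group of the structure group. -/
theorem structure_add_closure :
    letI := structureBrace h
    AddSubgroup.closure (Set.range (ι r)) = ⊤ := by
  letI := structureBrace h
  rw [eq_top_iff]
  intro b _
  have hb : b ∈ Subgroup.closure (Set.range (ι r)) := by rw [closure_ι]; trivial
  induction hb using Subgroup.closure_induction_right with
  | one =>
    have := zero_mem (AddSubgroup.closure (Set.range (ι r)))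
    rwa [LeftBrace.zero_eq_one] at this
  | mul_right b _ y hy ih =>
    obtain ⟨x, rfl⟩ := hy
    have e := structure_add_ι h b (fHom h b x)
    rw [show (fHom h b)⁻¹ (fHom h b x) = x from (fHom h b).symm_apply_apply x] at e
    have := add_mem (ih trivial) (AddSubgroup.subset_closure ⟨fHom h b x, rfl⟩)
    exact e ▸ this
  | mul_inv_cancel b _ y hy ih =>
    obtain ⟨x, rfl⟩ := hy
    have e := structure_add_ι h (b * (ι r x)⁻¹) (fHom h (b * (ι r x)⁻¹) x)
    rw [show (fHom h (b * (ι r x)⁻¹))⁻¹ (fHom h (b * (ι r x)⁻¹) x) = x from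
      (fHom h (b * (ι r x)⁻¹)).symm_apply_apply x, inv_mul_cancel_right] at e
    have e' := eq_sub_of_add_eq e
    have := sub_mem (ih trivial)
      (AddSubgroup.subset_closure ⟨fHom h (b * (ι r x)⁻¹) x, rfl⟩)
    exact e' ▸ this

end structureBrace

/-! ### The permutation group and its left brace structure -/

section permBrace

variable {r : X × X → X × X} (h : IsInvSolution r)

/-- The permutation group, generated by the pairs `(f_x, g̃_x⁻¹)`. -/
noncomputable def permGroup : Subgroup (Equiv.Perm X × Equiv.Perm X) :=
  Subgroup.closure (Set.range fun x : X => (fPerm h x, (gTilde h x)⁻¹))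

/-- The generator `(f_x, g̃_x⁻¹)` of the permutation group. -/
noncomputable def permGen (x : X) : permGroup h :=
  ⟨(fPerm h x, (gTilde h x)⁻¹), Subgroup.subset_closure ⟨x, rfl⟩⟩

/-- The projection of the structure group onto the permutation group, `ι(x) ↦ (f_x, g̃_x⁻¹)`. -/
noncomputable def toPerm : StructureGroup r →* permGroup h :=
  PresentedGroup.toGroup (f := permGen h) (by
    rintro _ ⟨x, y, rfl⟩
    rw [map_mul, map_inv, map_mul, map_mul]
    simp only [FreeGroup.lift_apply_of]
    refine mul_inv_eq_one.mpr (Subtype.ext ?_)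
    change (fPerm h x * fPerm h y, (gTilde h x)⁻¹ * (gTilde h y)⁻¹) =
      (fPerm h (f r x y) * fPerm h (g r y x),
        (gTilde h (f r x y))⁻¹ * (gTilde h (g r y x))⁻¹)
    simp only [gTilde_inv, fPerm_mul h x y])

theorem toPerm_ι (x : X) : toPerm h (ι r x) = permGen h x := PresentedGroup.toGroup.of _

theorem toPerm_fst (b : StructureGroup r) : (toPerm h b).1.1 = fHom h b := by
  have : ((MonoidHom.fst _ _).comp ((permGroup h).subtype.comp (toPerm h))) = fHom h := by
    apply PresentedGroup.ext
    intro x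
    change (toPerm h (ι r x)).1.1 = fHom h (ι r x)
    rw [toPerm_ι, fHom_ι]
    rfl
  exact DFunLike.congr_fun this b

theorem toPerm_surjective : Function.Surjective (toPerm h) := by
  rintro ⟨s, hs⟩
  induction hs using Subgroup.closure_induction with
  | mem y hy =>
    obtain ⟨x, rfl⟩ := hy
    exact ⟨ι r x, toPerm_ι h x⟩
  | one => exact ⟨1, map_one _⟩
  | mul s t _ _ hs ht =>
    obtain ⟨a, ha⟩ := hs
    obtain ⟨b, hb⟩ := ht
    exact ⟨a * b, by rw [map_mul, ha, hb]; rfl⟩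
  | inv s _ hs =>
    obtain ⟨a, ha⟩ := hs
    exact ⟨a⁻¹, by rw [map_inv, ha]; rfl⟩

/-- The projection identifies elements compatibly with the sum. -/
theorem toPerm_add_congr {a a' b b' : StructureGroup r} (ha : toPerm h a = toPerm h a')
    (hb : toPerm h b = toPerm h b') :
    letI := structureBrace h
    toPerm h (a + b) = toPerm h (a' + b') := by
  letI := structureBrace h
  have step : ∀ (x : X) (u u' : StructureGroup r),
      toPerm h (u + ι r x) = toPerm h (u' + ι r x) ↔ toPerm h u = toPerm h u' := by
    have fwd : ∀ (x : X) (u u' : StructureGroup r), toPerm h u = toPerm h u' →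
        toPerm h (u + ι r x) = toPerm h (u' + ι r x) := by
      intro x u u' hu
      have e : fHom h u = fHom h u' := by rw [← toPerm_fst, ← toPerm_fst, hu]
      rw [structure_add_ι, structure_add_ι]
      rw [map_mul, map_mul, hu, e]
    intro x u u'
    refine ⟨fun hu => ?_, fwd x u u'⟩
    rw [structure_add_ι, structure_add_ι] at hu
    have key : ∀ w : StructureGroup r,
        (fPerm h ((fHom h w)⁻¹ x))⁻¹ ((fHom h w)⁻¹ x) =
          (toPerm h (w * ι r ((fHom h w)⁻¹ x))).1.1⁻¹ x := by
      intro w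
      rw [toPerm_fst, map_mul, fHom_ι, mul_inv_rev, Equiv.Perm.mul_apply]
    have k := (key u).trans ((congrArg (fun s : permGroup h => s.1.1⁻¹ x) hu).trans (key u').symm)
    have e := (diag_bijective h).1 k
    rw [e, map_mul, map_mul] at hu
    exact mul_right_cancel hu
  have all : ∀ c u u' : StructureGroup r,
      toPerm h (u + c) = toPerm h (u' + c) ↔ toPerm h u = toPerm h u' := by
    intro c
    have hc : c ∈ AddSubgroup.closure (Set.range (ι r)) := by
      rw [structure_add_closure]; trivial
    induction hc using AddSubgroup.closure_induction with
    | mem y hy =>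
      obtain ⟨x, rfl⟩ := hy
      exact step x
    | zero => intro u u'; rw [add_zero, add_zero]
    | add c d _ _ ihc ihd => intro u u'; rw [← add_assoc, ← add_assoc, ihd, ihc]
    | neg c _ ih =>
      intro u u'
      have := ih (u + -c) (u' + -c)
      rw [neg_add_cancel_right, neg_add_cancel_right] at this
      exact this.symm
  calc toPerm h (a + b) = toPerm h (a' + b) := (all b a a').mpr ha
    _ = toPerm h (b + a') := by rw [add_comm]
    _ = toPerm h (b' + a') := (all a' b b').mpr hb
    _ = toPerm h (a' + b') := by rw [add_comm]

/-- The sum of the permutation group: add preimages in the structure group and project. -/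
noncomputable def permAdd (s t : permGroup h) : permGroup h :=
  letI := structureBrace h
  toPerm h (Function.surjInv (toPerm_surjective h) s + Function.surjInv (toPerm_surjective h) t)

theorem permAdd_toPerm (a b : StructureGroup r) :
    letI := structureBrace h
    permAdd h (toPerm h a) (toPerm h b) = toPerm h (a + b) :=
  toPerm_add_congr h (Function.surjInv_eq _ _) (Function.surjInv_eq _ _)

/-- The left brace structure of the permutation group: the product is the composition and the
sum is induced by the sum of the structure group. -/
noncomputable instance permBrace : LeftBrace (permGroup h) :=
  letI := structureBrace h
  { (inferInstance : Group (permGroup h)) with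
    add := permAdd h
    zero := toPerm h 0
    neg := fun s => toPerm h (-Function.surjInv (toPerm_surjective h) s)
    nsmul := @nsmulRec _ ⟨toPerm h 0⟩ ⟨permAdd h⟩
    zsmul := @zsmulRec _ ⟨toPerm h 0⟩ ⟨permAdd h⟩
      ⟨fun s => toPerm h (-Function.surjInv (toPerm_surjective h) s)⟩
      (@nsmulRec _ ⟨toPerm h 0⟩ ⟨permAdd h⟩)
    add_assoc := by
      intro s t u
      obtain ⟨a, rfl⟩ := toPerm_surjective h s
      obtain ⟨b, rfl⟩ := toPerm_surjective h t
      obtain ⟨c, rfl⟩ := toPerm_surjective h u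
      change permAdd h (permAdd h _ _) _ = permAdd h _ (permAdd h _ _)
      rw [permAdd_toPerm, permAdd_toPerm, permAdd_toPerm, permAdd_toPerm, add_assoc]
    zero_add := by
      intro s
      obtain ⟨a, rfl⟩ := toPerm_surjective h s
      change permAdd h (toPerm h 0) _ = _
      rw [permAdd_toPerm, zero_add]
    add_zero := by
      intro s
      obtain ⟨a, rfl⟩ := toPerm_surjective h s
      change permAdd h _ (toPerm h 0) = _
      rw [permAdd_toPerm, add_zero]
    add_comm := by
      intro s t
      obtain ⟨a, rfl⟩ := toPerm_surjective h s
      obtain ⟨b, rfl⟩ := toPerm_surjective h t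
      change permAdd h _ _ = permAdd h _ _
      rw [permAdd_toPerm, permAdd_toPerm, add_comm]
    neg_add_cancel := by
      intro s
      have e := permAdd_toPerm h (-Function.surjInv (toPerm_surjective h) s)
        (Function.surjInv (toPerm_surjective h) s)
      rw [Function.surjInv_eq (toPerm_surjective h) s, neg_add_cancel] at e
      exact e
    mul_add_add' := by
      intro s t u
      obtain ⟨a, rfl⟩ := toPerm_surjective h s
      obtain ⟨b, rfl⟩ := toPerm_surjective h t
      obtain ⟨c, rfl⟩ := toPerm_surjective h u
      change permAdd h (toPerm h a * permAdd h (toPerm h b) (toPerm h c)) (toPerm h a) =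
        permAdd h (toPerm h a * toPerm h b) (toPerm h a * toPerm h c)
      rw [permAdd_toPerm, ← map_mul, ← map_mul, ← map_mul, permAdd_toPerm, permAdd_toPerm,
        LeftBrace.mul_add_add] }

/-- The projection of the structure group onto the permutation group is additive. -/
theorem toPerm_add (a b : StructureGroup r) :
    letI := structureBrace h
    toPerm h (a + b) = toPerm h a + toPerm h b :=
  (permAdd_toPerm h a b).symm

/-- In the permutation group, `s + (f_x, g̃_x⁻¹) = s ∘ (f_y, g̃_y⁻¹)` with `y = s⁻¹(x)`. -/
theorem perm_add_gen (s : permGroup h) (x : X) :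
    s + permGen h x = s * permGen h (s.1.1⁻¹ x) := by
  letI := structureBrace h
  obtain ⟨a, rfl⟩ := toPerm_surjective h s
  rw [← toPerm_ι, ← toPerm_ι, toPerm_fst, ← map_mul, ← structure_add_ι]
  exact (toPerm_add h a (ι r x)).symm

end permBrace

end YB

/-! ### The construction -/

open LeftBrace in
/-- The data of the construction, for a left brace `B` with a chosen element `rep i` in each
orbit `i` of the action `λ`. -/
structure CosetData {B : Type*} [LeftBrace B] (rep : LamOrbits B → B) where
  /-- a non-empty set of orbits -/
  I : Set (LamOrbits B)
  I_nonempty : I.Nonempty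
  /-- the union of the chosen orbits generates `(B, +)` -/
  generates : AddSubgroup.closure (⋃ i ∈ I, (i : Set B)) = ⊤
  J : I → Type*
  J_nonempty : ∀ i, Nonempty (J i)
  K : (i : I) → J i → Subgroup B
  K_le : ∀ i j, K i j ≤ St (rep i)
  /-- the cores in `(B, *)` intersect trivially -/
  core : ⨅ i, ⨅ j, (K i j).normalCore = ⊥

namespace CosetData

open LeftBrace

variable {B : Type*} [LeftBrace B] {rep : LamOrbits B → B} (D : CosetData rep)

/-- The disjoint union of the sets of left cosets `B/K_{i,j}`. -/
def X : Type _ := Σ i : D.I, Σ j : D.J i, B ⧸ D.K i j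

/-- The coset `b K_{i,j}` as an element of the disjoint union. -/
def coset (i : D.I) (j : D.J i) (b : B) : D.X := ⟨i, j, (b : B ⧸ D.K i j)⟩

/-- The map `b K_{i,j} ↦ λ_b(a_i)`. -/
def val (x : D.X) : B :=
  Quotient.liftOn' x.2.2 (fun b => lam b (rep x.1)) (by
    intro b b' hb
    have hm : b⁻¹ * b' ∈ St (rep x.1) := D.K_le _ _ (QuotientGroup.leftRel_apply.mp hb)
    have hm' : lam (b⁻¹ * b') (rep x.1) = rep x.1 := hm
    change lam b (rep x.1) = lam b' (rep x.1)
    conv_lhs => rw [← hm']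
    rw [← lam_mul, mul_inv_cancel_left])

/-- Left multiplication by `b` on the disjoint union of the coset spaces. -/
def act (b : B) : Equiv.Perm D.X where
  toFun x := ⟨x.1, x.2.1, b • x.2.2⟩
  invFun x := ⟨x.1, x.2.1, b⁻¹ • x.2.2⟩
  left_inv x := by simp; rfl
  right_inv x := by simp; rfl

/-- The permutation `f_x`, given by `f_{b₁K}(b₂K') = λ_{b₁}(a_{i₁}) b₂ K'`. -/
def f (x : D.X) : Equiv.Perm D.X := D.act (D.val x)

theorem f_coset (i₁ : D.I) (j₁ : D.J i₁) (b₁ : B) (i₂ : D.I) (j₂ : D.J i₂) (b₂ : B) :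
    D.f (D.coset i₁ j₁ b₁) (D.coset i₂ j₂ b₂) =
      D.coset i₂ j₂ (lam b₁ (rep i₁) * b₂) := rfl

/-- The map `r(x, y) = (f_x(y), f_z⁻¹(x))` with `z = f_x(y)`. -/
def r (p : D.X × D.X) : D.X × D.X :=
  (D.f p.1 p.2, (D.f (D.f p.1 p.2))⁻¹ p.1)

end CosetData

universe u v

/-! Both halves pass through one notion: a set `X` with a faithful action of `(B, ·)` and an
equivariant map `v : X → B`, `v (b • x) = λ_b (v x)`, whose image generates `(B, +)`. Such a pair
gives `f_x(y) = v x • y`, and `ofVal v` is the resulting involutive map.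

The braid relation comes from `ab = a + λ_a(b)`: the right side is a symmetric sum, so `r` preserves
the product `v x * v y`. In the coordinates `sumCoord`, `r₁` and `r₂` become adjacent
transpositions, and the braid relation is that of the symmetric group on three letters.
Non-degeneracy reduces to bijectivity of `x ↦ (v x)⁻¹ • x`. Sending `b` to its action identifies `B`
with the permutation group as a left brace, `v x` going to the generator of `x`
(`permGroup_ofVal_isomorphic`).

Coset data are such pairs split into orbits: `val` is the equivariant map, and trivial intersection
of the cores is faithfulness. Conversely, a solution with permutation brace `B` gives the action
through `f` and the map `v` sending `x` to its generator. In each orbit of `Z` a base point is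
chosen whose value is the prescribed `a_i`; its stabiliser lies in `St(a_i)` by equivariance and
serves as `K`. -/

namespace LeftBrace

/-! ### Identities for `λ` and generation of the two groups. -/

variable {B : Type*} [LeftBrace B]

theorem lam_neg (a b : B) : lam a (-b) = -lam a b := by
  have h := lam_add a b (-b)
  rw [add_neg_cancel, lam, mul_zero_eq, neg_add_cancel] at h
  exact (neg_eq_of_add_eq_zero_right h.symm).symm

theorem lam_inv_lam (a b : B) : lam a⁻¹ (lam a b) = b := by
  rw [← lam_mul, inv_mul_cancel, lam_one]

theorem lam_lam_inv (a b : B) : lam a (lam a⁻¹ b) = b := by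
  rw [← lam_mul, mul_inv_cancel, lam_one]

theorem mul_lam_inv (a b : B) : a * lam a⁻¹ b = a + b := by
  rw [mul_eq, lam_lam_inv]

theorem lam_inv_self (a : B) : lam a⁻¹ a = -a⁻¹ := by
  rw [lam, inv_mul_cancel, ← zero_eq_one, add_zero]

/-- Both products equal `a + λ_a(b)`, read in the two orders of the sum. This is the source of the
braid relation. -/
theorem mul_eq_lam_mul (a b : B) : a * b = lam a b * lam (lam a b)⁻¹ a := by
  rw [mul_lam_inv, mul_eq, add_comm]

theorem mem_lamOrbit_self (a : B) : a ∈ lamOrbit a := ⟨1, lam_one a⟩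

theorem lamOrbit_eq_of_mem {a c : B} (h : c ∈ lamOrbit a) : lamOrbit c = lamOrbit a := by
  obtain ⟨b, rfl⟩ := h
  ext d
  constructor
  · rintro ⟨e, rfl⟩
    exact ⟨e * b, lam_mul _ _ _⟩
  · rintro ⟨e, rfl⟩
    exact ⟨e * b⁻¹, by rw [lam_mul, lam_inv_lam]⟩

/-- A subset that is stable under `λ` and generates the additive group generates the
multiplicative group. -/
theorem closure_eq_top_of_addClosure_eq_top {S : Set B} (hS : ∀ b, ∀ s ∈ S, lam b s ∈ S)
    (h : AddSubgroup.closure S = ⊤) : Subgroup.closure S = ⊤ := by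
  rw [eq_top_iff]
  intro b _
  have hb : b ∈ AddSubgroup.closure S := by rw [h]; trivial
  induction hb using AddSubgroup.closure_induction_right with
  | zero => rw [zero_eq_one]; exact one_mem _
  | add_right b _ s hs ih =>
    rw [← mul_lam_inv]
    exact mul_mem (ih trivial) (Subgroup.subset_closure (hS _ _ hs))
  | add_neg_cancel b _ s hs ih =>
    rw [← mul_lam_inv, lam_neg]
    refine mul_mem (ih trivial) ?_
    set c := lam b⁻¹ s
    -- Subtracting `s` multiplies by `-c`, which is not in `S`; it is, however, the inverse of a
    -- `λ`-translate of `c`, hence of an element of `S`.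
    have e : (lam (-c)⁻¹ c)⁻¹ = -c := by
      have := lam_inv_self (-c)
      rw [lam_neg, neg_inj] at this
      rw [this, inv_inv]
    rw [← e]
    exact inv_mem (Subgroup.subset_closure (hS _ _ (hS _ _ hs)))

end LeftBrace

namespace YB

open LeftBrace

/-! ### Solutions from an action and an equivariant map. -/

section ofVal

variable {B X : Type*} [LeftBrace B] [MulAction B X]

/-- The map `r(x, y) = (v(x) • y, v(v(x) • y)⁻¹ • x)` of a set with an action of a left brace `B`
and a map `v` to `B`. -/
def ofVal (v : X → B) (p : X × X) : X × X :=
  (v p.1 • p.2, (v (v p.1 • p.2))⁻¹ • p.1)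

variable {v : X → B}

theorem ofVal_involutive (v : X → B) : ofVal v ∘ ofVal v = id := by
  funext ⟨x, y⟩
  simp [ofVal]

/-- Coordinates on triples in which `r × id` and `id × r` are the transpositions. -/
def sumCoord (v : X → B) (p : X × X × X) : X × X × X :=
  (p.1, v p.1 • p.2.1, (v p.1 * v p.2.1) • p.2.2)

theorem sumCoord_injective (v : X → B) : Function.Injective (sumCoord v) := by
  rintro ⟨x, y, z⟩ ⟨x', y', z'⟩ h
  simp only [sumCoord, Prod.mk.injEq] at h
  obtain ⟨rfl, h1, h2⟩ := h
  obtain rfl := smul_left_cancel _ h1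
  obtain rfl := smul_left_cancel _ h2
  rfl

theorem val_ofVal_mul (hv : ∀ (b : B) (x : X), v (b • x) = lam b (v x)) (x y : X) :
    v (v x • y) * v ((v (v x • y))⁻¹ • x) = v x * v y := by
  rw [hv _ x, hv, ← mul_eq_lam_mul]

theorem sumCoord_r₁ (hv : ∀ (b : B) (x : X), v (b • x) = lam b (v x)) (p : X × X × X) :
    sumCoord v (r₁ (ofVal v) p) =
      ((sumCoord v p).2.1, (sumCoord v p).1, (sumCoord v p).2.2) := by
  obtain ⟨x, y, z⟩ := p
  simp only [sumCoord, r₁, ofVal, val_ofVal_mul hv, smul_inv_smul]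

theorem sumCoord_r₂ (v : X → B) (p : X × X × X) :
    sumCoord v (r₂ (ofVal v) p) =
      ((sumCoord v p).1, (sumCoord v p).2.2, (sumCoord v p).2.1) := by
  obtain ⟨x, y, z⟩ := p
  simp only [sumCoord, r₂, ofVal, mul_smul, smul_inv_smul]

/-- On values the map is `a ↦ -a⁻¹`, which is invertible, so `v x`, and with it `x`, can be
recovered from the image. -/
theorem inv_val_smul_bijective (hv : ∀ (b : B) (x : X), v (b • x) = lam b (v x)) :
    Function.Bijective (fun x : X => (v x)⁻¹ • x) := by
  have h₁ (x : X) : v ((v x)⁻¹ • x) = -(v x)⁻¹ := by rw [hv, lam_inv_self]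
  refine Function.bijective_iff_has_inverse.mpr ⟨fun y => (-v y)⁻¹ • y, fun x => ?_, fun y => ?_⟩
  · simp only [h₁, neg_neg, inv_inv, smul_inv_smul]
  · have h₂ : v ((-v y)⁻¹ • y) = (-v y)⁻¹ := by
      have := lam_inv_self (-v y)
      rw [lam_neg, neg_inj] at this
      rw [hv, this]
    simp only [h₂, inv_inv, smul_inv_smul]

theorem ofVal_nonDegenerate (hv : ∀ (b : B) (x : X), v (b • x) = lam b (v x)) :
    NonDegenerate (ofVal v) := by
  intro y
  refine ⟨MulAction.bijective (v y), ?_⟩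
  have hT := inv_val_smul_bijective hv
  refine (hT.of_comp_iff' _).mp ?_
  -- With `T x = (v x)⁻¹ • x`, invariance of `v x * v y` gives `T (g_y x) = (v x * v y)⁻¹ • x = (v
  -- y)⁻¹ • T x`, so `g_y` is conjugate by `T` to the action of `(v y)⁻¹`.
  have e : (fun x : X => (v x)⁻¹ • x) ∘ g (ofVal v) y =
      (fun x : X => (v y)⁻¹ • x) ∘ (fun x : X => (v x)⁻¹ • x) := by
    funext x
    have h := val_ofVal_mul hv x y
    simp only [Function.comp_apply, g, ofVal, smul_smul, ← mul_inv_rev, h]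
  rw [e]
  exact (MulAction.bijective (v y)⁻¹).comp hT

theorem isInvSolution_ofVal [hX : Nonempty X] (hv : ∀ (b : B) (x : X), v (b • x) = lam b (v x)) :
    IsInvSolution (ofVal v) where
  nonempty := hX
  bijective := (Function.Involutive.bijective fun p => congrFun (ofVal_involutive v) p)
  braid := by
    funext p
    -- In these coordinates both sides exchange the first and third entries.
    apply sumCoord_injective v
    simp only [Function.comp_apply, sumCoord_r₁ hv, sumCoord_r₂]
  nonDegenerate := ofVal_nonDegenerate hv
  involutive := ofVal_involutive v

/-- The pair of permutations given by the action of an element. -/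
def diagPerm (B X : Type*) [LeftBrace B] [MulAction B X] : B →* Equiv.Perm X × Equiv.Perm X :=
  (MulAction.toPermHom B X).prod (MulAction.toPermHom B X)

theorem diagPerm_val (h : IsInvSolution (ofVal v)) (x : X) :
    diagPerm B X (v x) = (permGen h x).1 := by
  have e : fPerm h x = MulAction.toPermHom B X (v x) := Equiv.ext fun _ => rfl
  refine Prod.ext e.symm ?_
  exact e.symm.trans (gTilde_inv h x).symm

theorem range_val_stable (hv : ∀ (b : B) (x : X), v (b • x) = lam b (v x)) (b : B) :
    ∀ s ∈ Set.range v, lam b s ∈ Set.range v := by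
  rintro _ ⟨x, rfl⟩
  exact ⟨b • x, hv b x⟩

theorem range_diagPerm (hv : ∀ (b : B) (x : X), v (b • x) = lam b (v x))
    (hgen : AddSubgroup.closure (Set.range v) = ⊤) (h : IsInvSolution (ofVal v)) :
    (diagPerm B X).range = permGroup h := by
  rw [MonoidHom.range_eq_map,
    ← closure_eq_top_of_addClosure_eq_top (range_val_stable hv) hgen, MonoidHom.map_closure,
    permGroup, ← Set.range_comp]
  congr 2
  funext x
  exact diagPerm_val h x

/-- If the action is faithful and `v` generates the additive group, the permutation group is the
left brace `B`. -/
theorem permGroup_ofVal_isomorphic [FaithfulSMul B X]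
    (hv : ∀ (b : B) (x : X), v (b • x) = lam b (v x))
    (hgen : AddSubgroup.closure (Set.range v) = ⊤) (h : IsInvSolution (ofVal v)) :
    Isomorphic (permGroup h) B := by
  have hmem (b : B) : diagPerm B X b ∈ permGroup h := by
    rw [← range_diagPerm hv hgen h]; exact ⟨b, rfl⟩
  let φ : B →* permGroup h := (diagPerm B X).codRestrict (permGroup h) hmem
  have hinj : Function.Injective φ := by
    intro a b hab
    have h1 : MulAction.toPermHom B X a = MulAction.toPermHom B X b :=
      congrArg (fun s : permGroup h => s.1.1) hab
    exact MulAction.toPerm_injective h1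
  have hsurj : Function.Surjective φ := by
    rintro ⟨s, hs⟩
    rw [← range_diagPerm hv hgen h] at hs
    obtain ⟨b, rfl⟩ := hs
    exact ⟨b, rfl⟩
  have hval (x : X) : φ (v x) = permGen h x := Subtype.ext (diagPerm_val h x)
  have hstep (b : B) (x : X) : φ (b + v x) = φ b + φ (v x) := by
    -- In `B`, `b + v x = b * v (b⁻¹ • x)`; the permutation group adds a generator by the same rule.
    rw [hval, perm_add_gen, ← mul_lam_inv, ← hv, map_mul, hval]
    rfl
  have hadd (c : B) : ∀ b : B, φ (b + c) = φ b + φ c := by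
    have hc : c ∈ AddSubgroup.closure (Set.range v) := by rw [hgen]; trivial
    induction hc using AddSubgroup.closure_induction with
    | mem _ hs =>
      obtain ⟨x, rfl⟩ := hs
      exact fun b => hstep b x
    | zero =>
      intro b
      have e : φ 0 = 0 := by
        rw [zero_eq_one, map_one]
        exact (zero_eq_one (B := permGroup h)).symm
      rw [e, add_zero, add_zero]
    | add c d _ _ ihc ihd => intro b; rw [← add_assoc, ihd, ihc, ihd c, add_assoc]
    | neg c _ ih =>
      -- Taking `b = 0` here later yields `φ (-c) = -φ c`.
      have key (b : B) : φ (b + -c) = φ b - φ c := by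
        rw [eq_sub_iff_add_eq, ← ih, neg_add_cancel_right]
      have e : φ 0 = 0 := by
        rw [zero_eq_one, map_one]
        exact (zero_eq_one (B := permGroup h)).symm
      intro b
      have e' := key 0
      rw [zero_add, e, zero_sub] at e'
      rw [key, e', sub_eq_add_neg]
  let e : B ≃ permGroup h := Equiv.ofBijective φ ⟨hinj, hsurj⟩
  refine ⟨e.symm, fun s t => ?_, fun s t => ?_⟩
  · rw [Equiv.symm_apply_eq]
    change s + t = φ _
    rw [hadd]
    exact (congrArg₂ (· + ·) (e.apply_symm_apply s) (e.apply_symm_apply t)).symm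
  · rw [Equiv.symm_apply_eq]
    change s * t = φ _
    rw [map_mul]
    exact (congrArg₂ (· * ·) (e.apply_symm_apply s) (e.apply_symm_apply t)).symm

end ofVal

end YB

/-! ### Coset data as a faithful action with an equivariant map. -/

namespace CosetData

open LeftBrace YB

variable {B : Type*} [LeftBrace B] {rep : LamOrbits B → B} (D : CosetData rep)

instance : MulAction B D.X where
  smul b x := D.act b x
  one_smul := by
    rintro ⟨i, j, q⟩
    change (⟨i, j, (1 : B) • q⟩ : D.X) = _
    rw [one_smul]
  mul_smul := by
    rintro a b ⟨i, j, q⟩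
    change (⟨i, j, (a * b) • q⟩ : D.X) = ⟨i, j, a • b • q⟩
    rw [mul_smul]

theorem smul_coset (b : B) (i : D.I) (j : D.J i) (c : B) :
    b • D.coset i j c = D.coset i j (b * c) := rfl

theorem val_coset (i : D.I) (j : D.J i) (b : B) : D.val (D.coset i j b) = lam b (rep i) := rfl

theorem exists_eq_coset (x : D.X) : ∃ i j b, x = D.coset i j b := by
  obtain ⟨i, j, q⟩ := x
  obtain ⟨b, rfl⟩ := QuotientGroup.mk_surjective q
  exact ⟨i, j, b, rfl⟩

theorem coset_eq_coset {i : D.I} {j : D.J i} {b c : B} :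
    D.coset i j b = D.coset i j c ↔ b⁻¹ * c ∈ D.K i j := by
  rw [← QuotientGroup.eq]
  constructor
  · intro h
    have h₁ := eq_of_heq (Sigma.mk.inj h).2
    exact eq_of_heq (Sigma.mk.inj h₁).2
  · intro h
    exact congrArg (fun q : B ⧸ D.K i j => (⟨i, j, q⟩ : D.X)) h

theorem val_smul (b : B) (x : D.X) : D.val (b • x) = lam b (D.val x) := by
  obtain ⟨i, j, c, rfl⟩ := D.exists_eq_coset x
  rw [smul_coset, val_coset, val_coset, lam_mul]

theorem r_eq_ofVal : D.r = ofVal D.val := rfl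

instance : Nonempty D.X := by
  obtain ⟨i, hi⟩ := D.I_nonempty
  obtain ⟨j⟩ := D.J_nonempty ⟨i, hi⟩
  exact ⟨D.coset ⟨i, hi⟩ j 1⟩

instance : FaithfulSMul B D.X := by
  refine ⟨fun {a b} h => ?_⟩
  have hm : a⁻¹ * b ∈ (⨅ i, ⨅ j, (D.K i j).normalCore : Subgroup B) := by
    simp only [Subgroup.mem_iInf]
    intro i j c
    -- Agreement of `a` and `b` on the coset of `c⁻¹` puts `c * (a⁻¹ * b) * c⁻¹` in `K i j`; varying
    -- `c` gives the normal core.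
    have h₁ := h (D.coset i j c⁻¹)
    rw [smul_coset, smul_coset, coset_eq_coset] at h₁
    simpa [mul_assoc] using h₁
  rw [D.core, Subgroup.mem_bot] at hm
  exact inv_mul_eq_one.mp hm

/-- Since `rep i` lies in `i` and `J i` is non-empty, the values on the cosets over `i` fill the
whole orbit `i`. -/
theorem closure_range_val (hrep : ∀ i : LamOrbits B, rep i ∈ (i : Set B)) :
    AddSubgroup.closure (Set.range D.val) = ⊤ := by
  rw [eq_top_iff, ← D.generates, AddSubgroup.closure_le]
  intro c hc
  simp only [Set.mem_iUnion] at hc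
  obtain ⟨⟨_, a, rfl⟩, hi, hc⟩ := hc
  obtain ⟨j⟩ := D.J_nonempty ⟨_, hi⟩
  change c ∈ lamOrbit a at hc
  have hr : rep ⟨lamOrbit a, a, rfl⟩ ∈ lamOrbit a := hrep ⟨lamOrbit a, a, rfl⟩
  rw [← lamOrbit_eq_of_mem hr] at hc
  obtain ⟨b, hb⟩ := hc
  exact AddSubgroup.subset_closure ⟨D.coset ⟨_, hi⟩ j b, hb⟩

end CosetData

/-! ### Orbit decomposition of an arbitrary faithful pair. -/

namespace YB

open LeftBrace

/-- Every solution given by a faithful action and a generating map to `B` is isomorphic to one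
on coset spaces. -/
theorem exists_cosetData_solIsomorphic {B : Type u} [LeftBrace B]
    (rep : LamOrbits B → B) (hrep : ∀ i : LamOrbits B, rep i ∈ (i : Set B))
    {Z : Type v} [hZ : Nonempty Z] [MulAction B Z] [FaithfulSMul B Z] {v : Z → B}
    (hv : ∀ (b : B) (x : Z), v (b • x) = lam b (v x))
    (hgen : AddSubgroup.closure (Set.range v) = ⊤) :
    ∃ D : CosetData.{u, v} rep, SolIsomorphic D.r (ofVal v) := by
  let cls (z : Z) : LamOrbits B := ⟨lamOrbit (v z), v z, rfl⟩
  let Q := MulAction.orbitRel.Quotient B Z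
  -- By equivariance `v` maps an orbit of `Z` onto a full `λ`-orbit, so the prescribed
  -- representative is attained.
  have hex (q : Q) : ∃ z : Z, (Quotient.mk'' z : Q) = q ∧ v z = rep (cls q.out) := by
    obtain ⟨b, hb⟩ : rep (cls q.out) ∈ lamOrbit (v q.out) := hrep (cls q.out)
    refine ⟨b • q.out, ?_, by rw [hv, hb]⟩
    conv_rhs => rw [← Quotient.out_eq' q]
    exact Quotient.sound' ⟨b, rfl⟩
  choose ρ hρ hvρ using hex
  have horb (z : Z) : ∃ b : B, b • ρ (Quotient.mk'' z) = z :=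
    Quotient.exact' (hρ (Quotient.mk'' z)).symm
  have hcls (z : Z) : cls z = cls (Quotient.mk'' z : Q).out := by
    have : (Quotient.mk'' z : Q) = Quotient.mk'' (Quotient.mk'' z : Q).out :=
      (Quotient.out_eq' _).symm
    obtain ⟨b, hb⟩ := Quotient.exact' this
    refine Subtype.ext (lamOrbit_eq_of_mem ⟨b, ?_⟩)
    rw [← hv]
    exact congrArg v hb
  let D : CosetData.{u, v} rep :=
    { I := Set.range cls
      I_nonempty := Set.range_nonempty cls
      generates := by
        rw [eq_top_iff, ← hgen, AddSubgroup.closure_le]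
        rintro _ ⟨z, rfl⟩
        refine AddSubgroup.subset_closure ?_
        simp only [Set.mem_iUnion]
        exact ⟨cls z, ⟨z, rfl⟩, mem_lamOrbit_self (v z)⟩
      -- Several orbits of `Z` may lie over the same `λ`-orbit; `J i` lists them.
      J := fun i => {q : Q // cls q.out = i}
      J_nonempty := by
        rintro ⟨_, z, rfl⟩
        exact ⟨⟨Quotient.mk'' z, (hcls z).symm⟩⟩
      K := fun _ q => MulAction.stabilizer B (ρ q.1)
      K_le := by
        rintro i ⟨q, hq⟩ b hb
        have h₁ : b • ρ q = ρ q := hb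
        change lam b (rep i) = rep i
        rw [← hq, ← hvρ, ← hv, h₁]
      core := by
        rw [eq_bot_iff]
        intro b hb
        simp only [Subgroup.mem_iInf] at hb
        rw [Subgroup.mem_bot]
        refine FaithfulSMul.eq_of_smul_eq_smul (α := Z) fun z => ?_
        obtain ⟨c, hc⟩ := horb z
        -- The conjugate is chosen so that fixing the base point means that `b` fixes `z = c • ρ`.
        have h₁ : (c⁻¹ * b * c⁻¹⁻¹) • ρ (Quotient.mk'' z) = ρ (Quotient.mk'' z) :=
          hb ⟨_, z, rfl⟩ ⟨Quotient.mk'' z, (hcls z).symm⟩ c⁻¹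
        rw [inv_inv, mul_smul, hc, mul_smul, inv_smul_eq_iff, hc] at h₁
        rw [h₁, one_smul] }
  let F (x : D.X) : Z := Quotient.liftOn' x.2.2 (fun b : B => b • ρ x.2.1.1) (by
    intro b c hbc
    have h₁ : (b⁻¹ * c) • ρ x.2.1.1 = ρ x.2.1.1 := QuotientGroup.leftRel_apply.mp hbc
    rw [mul_smul, inv_smul_eq_iff] at h₁
    exact h₁.symm)
  have hF (i : D.I) (j : D.J i) (b : B) : F (D.coset i j b) = b • ρ j.1 := rfl
  have hFsmul (b : B) (x : D.X) : F (b • x) = b • F x := by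
    obtain ⟨i, j, c, rfl⟩ := D.exists_eq_coset x
    rw [D.smul_coset, hF, hF, mul_smul]
  have hFval (x : D.X) : v (F x) = D.val x := by
    obtain ⟨i, j, c, rfl⟩ := D.exists_eq_coset x
    rw [hF, hv, hvρ, D.val_coset, j.2]
  have hinj : Function.Injective F := by
    intro x y hxy
    obtain ⟨⟨i, hi⟩, ⟨q, hq⟩, b, rfl⟩ := D.exists_eq_coset x
    obtain ⟨⟨i', hi'⟩, ⟨q', hq'⟩, c, rfl⟩ := D.exists_eq_coset y
    change cls q.out = i at hq
    change cls q'.out = i' at hq'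
    have hxy' : b • ρ q = c • ρ q' := hxy
    have hqq : q = q' := by
      rw [← hρ q, ← hρ q']
      exact Quotient.sound' ⟨b⁻¹ * c, by
        change (b⁻¹ * c) • ρ q' = ρ q
        rw [mul_smul, ← hxy', inv_smul_smul]⟩
    subst hqq hq hq'
    rw [D.coset_eq_coset]
    change (b⁻¹ * c) • ρ q = ρ q
    rw [mul_smul, ← hxy', inv_smul_smul]
  have hsurj : Function.Surjective F := by
    intro z
    obtain ⟨b, hb⟩ := horb z
    exact ⟨D.coset ⟨_, z, rfl⟩ ⟨Quotient.mk'' z, (hcls z).symm⟩ b, hb⟩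
  refine ⟨D, Equiv.ofBijective F ⟨hinj, hsurj⟩, fun x y => ?_⟩
  change ofVal v (F x, F y) = (F (D.val x • y), F ((D.val (D.val x • y))⁻¹ • x))
  rw [hFsmul, hFsmul, ← hFval, ← hFval, hFsmul, hFval]
  simp only [ofVal, hFval]

/-! ### The generators of the permutation brace as an equivariant generating map. -/

section permGroup

variable {X : Type*} {r : X × X → X × X} (h : IsInvSolution r)

/-- It holds on generators because `g̃_x⁻¹ = f_x`. Consequently the action through the first
component alone is faithful. -/
theorem permGroup_fst_eq_snd (s : permGroup h) : s.1.1 = s.1.2 := by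
  have hle : permGroup h ≤
      (MonoidHom.fst (Equiv.Perm X) (Equiv.Perm X)).eqLocus (MonoidHom.snd _ _) := by
    rw [permGroup, Subgroup.closure_le]
    rintro _ ⟨x, rfl⟩
    exact (gTilde_inv h x).symm
  exact hle s.2

theorem lam_permGen (s : permGroup h) (x : X) :
    lam s (permGen h x) = permGen h (s.1.1 x) := by
  have e := perm_add_gen h s (s.1.1 x)
  rw [show s.1.1⁻¹ (s.1.1 x) = x from s.1.1.symm_apply_apply x] at e
  rw [lam, neg_add_eq_iff_eq_add]
  exact e.symm

/-- The projection from the structure group is additive and onto, and carries additive generators to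
the `permGen h x`. -/
theorem addClosure_range_permGen :
    AddSubgroup.closure (Set.range (permGen h)) = ⊤ := by
  letI := structureBrace h
  rw [eq_top_iff]
  intro s _
  obtain ⟨a, rfl⟩ := toPerm_surjective h s
  let ψ : StructureGroup r →+ permGroup h := AddMonoidHom.mk' (toPerm h) (toPerm_add h)
  have e : (AddSubgroup.closure (Set.range (ι r))).map ψ =
      AddSubgroup.closure (Set.range (permGen h)) := by
    rw [AddMonoidHom.map_closure, ← Set.range_comp]
    exact congrArg (fun k : X → permGroup h => AddSubgroup.closure (Set.range k))
      (funext (toPerm_ι h))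
  rw [← e, structure_add_closure]
  exact ⟨a, trivial, rfl⟩

end permGroup

end YB

/-! ### The converse and the main theorem. -/

open LeftBrace YB in
theorem YB.exists_cosetData_of_isomorphic {B : Type u} [LeftBrace B]
    (rep : LamOrbits B → B) (hrep : ∀ i : LamOrbits B, rep i ∈ (i : Set B))
    {Z : Type v} {t : Z × Z → Z × Z} (ht : IsInvSolution t) (hB : Isomorphic (permGroup ht) B) :
    ∃ D : CosetData.{u, v} rep, SolIsomorphic D.r t := by
  obtain ⟨e, hadd, hmul⟩ := hB
  have : Nonempty Z := ht.nonempty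
  let E : permGroup ht ≃* B := { e with map_mul' := hmul }
  let A : permGroup ht ≃+ B := { e with map_add' := hadd }
  letI : MulAction B Z := MulAction.compHom Z
    ((MonoidHom.fst _ _).comp ((permGroup ht).subtype.comp E.symm.toMonoidHom))
  have hsmul (s : permGroup ht) (z : Z) : e s • z = s.1.1 z := by
    change (E.symm (E s)).1.1 z = _
    rw [E.symm_apply_apply]
  let v (z : Z) : B := e (permGen ht z)
  have hv (b : B) (z : Z) : v (b • z) = lam b (v z) := by
    obtain ⟨s, rfl⟩ := e.surjective b
    change e _ = -A s + E s * E _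
    rw [hsmul, ← lam_permGen, lam, hadd, hmul]
    exact congrArg (· + e s * e (permGen ht z)) (map_neg A s)
  have : FaithfulSMul B Z := by
    refine ⟨fun {a b} hab => ?_⟩
    obtain ⟨s, rfl⟩ := e.surjective a
    obtain ⟨s', rfl⟩ := e.surjective b
    have h₁ : s.1.1 = s'.1.1 := by
      ext z
      rw [← hsmul, ← hsmul, hab]
    have h₂ : s.1.2 = s'.1.2 := by rw [← permGroup_fst_eq_snd, ← permGroup_fst_eq_snd, h₁]
    rw [Subtype.ext (Prod.ext h₁ h₂)]
  have hgen : AddSubgroup.closure (Set.range v) = ⊤ := by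
    have : Set.range v = A '' Set.range (permGen ht) := by rw [← Set.range_comp]; rfl
    rw [this]
    have h₁ := AddMonoidHom.map_closure A.toAddMonoidHom (Set.range (permGen ht))
    rw [addClosure_range_permGen, AddSubgroup.map_top_of_surjective _ A.surjective] at h₁
    exact h₁.symm
  -- First components agree by definition of the action; for an involutive solution they determine
  -- the second, by `g_eq`.
  have ht' : ofVal v = t := by
    funext ⟨x, y⟩
    have h₁ (x y : Z) : v x • y = f t x y := hsmul _ _
    have h₂ (x y : Z) : (v x)⁻¹ • y = (fPerm ht x)⁻¹ y := by
      rw [inv_smul_eq_iff]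
      exact ((hsmul _ _).trans ((fPerm ht x).apply_symm_apply y)).symm
    refine Prod.ext (h₁ x y) ?_
    change (v (v x • y))⁻¹ • x = g t y x
    rw [h₂, h₁, ← g_eq]
  rw [← ht']
  exact exists_cosetData_solIsomorphic rep hrep hv hgen

theorem mainTheorem4 {B : Type u} [LeftBrace B]
    (rep : LeftBrace.LamOrbits B → B) (hrep : ∀ i : LeftBrace.LamOrbits B, rep i ∈ (i : Set B)) :
    (∀ D : CosetData.{u, v} rep,
      ∃ h : YB.IsInvSolution D.r, LeftBrace.Isomorphic (YB.permGroup h) B) ∧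
    (∀ (Z : Type v) (t : Z × Z → Z × Z) (ht : YB.IsInvSolution t),
      LeftBrace.Isomorphic (YB.permGroup ht) B →
        ∃ D : CosetData.{u, v} rep, YB.SolIsomorphic D.r t) := by
  refine ⟨fun D => ?_, fun Z t ht hB => YB.exists_cosetData_of_isomorphic rep hrep ht hB⟩
  rw [D.r_eq_ofVal]
  have h := YB.isInvSolution_ofVal D.val_smul
  exact ⟨h, YB.permGroup_ofVal_isomorphic D.val_smul (D.closure_range_val hrep) h⟩
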